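/- Let $\delta>0$ and let $X$ be a geodesic metric space that is $\delta$-hyperbolic: for every geodesic triangle, each side lies in the union of the (closed) $\delta$-neighbourhoods of the other two. Let $G$ be a group that is not virtually cyclic, acting on $X$ by isometries, let $S$ be a finite generating set of $G$, and let $\|\cdot\|_S$ be the associated word norm. Let $f\in G$ be a unital axial loxodromic element, i.e. there is a bi-infinite geodesic $\gamma:\mathbb R\to X$ with $f\gamma(t)=\gamma(t+1)$ for all $t$; fix such a $\gamma$, put $Ax(f)=\gamma(\mathbb R)$ and let $x_0\in Ax(f)$. Assume that $f$ is WPD: for every $R>0$ there is an integer $L>0$ such that $\{g\in G: d_X(x_0,gx_0)<R \text{ and } d_X(f^Lx_0,gf^Lx_0)<R\}$ is finite. Write $(y|z)_x=\frac12\big(d_X(x,y)+d_X(x,z)-d_X(y,z)\big)$. For a geodesic $\alpha\subseteq X$ and $x,y\in X$ let $\pi_\alpha(x)$ be the set of points of $\alpha$ nearest to $x$ and $d_\alpha(x,y)=\operatorname{diam}\big(\pi_\alpha(x)\cup\pi_\alpha(y)\big)$. For $D,E\ge 0$ and $u\in G$, the $f$-halfspace with radius parameters $(D,E)$ determined by $u$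 is $$\mathcal H_{D,E,f}(u)=\big\{g\in G:\ (gx_0|ux_0)_{x_0}>D\ \text{ or there is no } h\in G \text{ with } \|h\|_S\le E \text{ and } d_{hAx(f)}(x_0,gx_0)\ge 250D\big\}.$$ Then there is $D_0>0$ such that for all $\varepsilon>0$, $D>D_0$ and $E,E'\ge 0$ there is a constant $N=N(\varepsilon,D,E,E')$ such that every finite set $A\subseteq G$ contains a subset $A'$ satisfying: 1. $\#A'\ge(1-\varepsilon)\,\#A$; 2. for each $a\in A'$ there are $f$-halfspaces $\mathcal H_1,\mathcal H_2\subseteq G$ with radius parameters $(D,E)$ such that $$\#\Big(A\setminus a\cdot\big((\mathcal H_1\cup\mathcal H_2)\setminus\{g\in G:\|g\|_S\le E'\}\big)\Big)\le N.$$ -/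

import Mathlib

open scoped Pointwise

noncomputable section

namespace MagicWPD

section Metric

variable {X : Type*} [MetricSpace X]

/-- `s` is (the image of) a geodesic from `x` to `y`: the image of an isometric embedding of the
interval `[0, dist x y]` that starts at `x` and ends at `y`. -/
def IsGeodesicSegment (s : Set X) (x y : X) : Prop :=
  ∃ γ : ℝ → X, γ 0 = x ∧ γ (dist x y) = y ∧
    (∀ t ∈ Set.Icc 0 (dist x y), ∀ t' ∈ Set.Icc 0 (dist x y), dist (γ t) (γ t') = |t - t'|) ∧
    s = γ '' Set.Icc 0 (dist x y)

variable (X) in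
/-- A geodesic metric space: any two points are joined by a geodesic. -/
def IsGeodesicSpace : Prop :=
  ∀ x y : X, ∃ s : Set X, IsGeodesicSegment s x y

/-- The `R`-neighbourhood of `A`: the points at distance at most `R` from some point of `A`. -/
def nbhd (R : ℝ) (A : Set X) : Set X :=
  {x | ∃ a ∈ A, dist a x ≤ R}

variable (X) in
/-- `δ`-hyperbolicity in the sense of Rips: all geodesic triangles are `δ`-thin. -/
def IsHyperbolic (δ : ℝ) : Prop :=
  ∀ (x y z : X) (sxy syz sxz : Set X), IsGeodesicSegment sxy x y → IsGeodesicSegment syz y z →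
    IsGeodesicSegment sxz x z → sxz ⊆ nbhd δ sxy ∪ nbhd δ syz

/-- The Gromov product `(y | z)_x`. -/
def gromovProduct (x y z : X) : ℝ :=
  (dist x y + dist x z - dist y z) / 2

/-- The nearest point projection of the point `x` to `A`, as a set. -/
def proj (A : Set X) (x : X) : Set X :=
  {a ∈ A | ∀ y ∈ A, dist x a ≤ dist x y}

/-- `d_A(x, y)`: the diameter of the union of the projections of `x` and `y` to `A`
(these are bounded sets). -/
def projDist (A : Set X) (x y : X) : ℝ :=
  Metric.diam (proj A x ∪ proj A y)

end Metric

section Group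

variable {G : Type*} [Group G]

/-- The word norm of `g` with respect to `S`: the least `n` such that `g` is a product of `n`
elements of `S ∪ S⁻¹`. -/
def wordNorm (S : Set G) (g : G) : ℕ :=
  sInf {n : ℕ | ∃ l : List G, l.length = n ∧ (∀ s ∈ l, s ∈ S ∪ S⁻¹) ∧ l.prod = g}

variable (G) in
/-- A group is virtually cyclic if it has a cyclic subgroup of finite index. -/
def IsVirtuallyCyclic : Prop :=
  ∃ H : Subgroup G, IsCyclic H ∧ H.FiniteIndex

end Group

section Action

variable {G X : Type*} [Group G] [MetricSpace X] [MulAction G X]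

/-- `γ` is a bi-infinite geodesic along which `f` translates by `1`. An isometry with such an axis
is a unital axial loxodromic isometry. -/
def IsUnitalAxis (f : G) (γ : ℝ → X) : Prop :=
  Isometry γ ∧ ∀ t : ℝ, f • γ t = γ (t + 1)

/-- Weak proper discontinuity along `f`, written with the basepoint `x₀` (the condition does not
depend on it). -/
def IsWPD (f : G) (x₀ : X) : Prop :=
  ∀ R : ℝ, 0 < R → ∃ L : ℕ, 0 < L ∧
    {g : G | dist x₀ (g • x₀) < R ∧ dist (f ^ L • x₀) (g • f ^ L • x₀) < R}.Finite

/-- The `f`-halfspace with radius parameters `(D, E)` determined by `u`, where `γ` parametrizes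
the axis of `f`. -/
def fHalfspace (S : Set G) (γ : ℝ → X) (x₀ : X) (D E : ℝ) (u : G) : Set G :=
  {g : G | D < gromovProduct x₀ (g • x₀) (u • x₀) ∨
    ¬ ∃ h : G, (wordNorm S h : ℝ) ≤ E ∧
      250 * D ≤ projDist (h • Set.range γ) x₀ (g • x₀)}

end Action

end MagicWPD

end

/-!
The complement of the two halfspaces at `a` consists of points `b` such that the geodesic from
`a • x₀` to `b • x₀` runs for a long time along one of the finitely many translates of the axis by
`a * h`, with `h` in the word ball of radius `E`. Each translate can be followed in two directions
(`direction`), so `a` has boundedly many directions, and the geodesics to all points of a direction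
pass near the same marked points of the translate (`axisMark`, `axisMark_of_mem_direction`).

Directions that contain few points of `A` contribute a bounded number of points to the complement.
If no three of the remaining, heavy directions at `a` diverge near `a • x₀`, then two of them give
halfspaces containing all heavy directions (`three_heavy_directions_or_two_halfspaces`). So it has
to be shown that few elements of `A` have three heavy diverging directions. In a tree this holds as
a finite tree with many branch points has many leaves: root the tree, observe that at least two of
the three branches at each branch point lead away from the root, and that at least as many branches
as there are branch points carry no further branch point; the points of `A` behind these are
disjoint heavy sets (`card_mul_le_of_branching`).

Two difficulties arise in a hyperbolic space. The space need not be locally finite, and many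
elements `a` may share almost the same point `a • x₀`; here weak proper discontinuity bounds the
number of translates of a fixed segment of the axis that lie at the same place on a given geodesic
(`card_le_of_segments`). This bounds the out-degrees of a relation of proximity between branches,
and an independent subset for the relation (`exists_independent_subset`) consists of branch points
that are far apart whenever they lie on a common geodesic from the root. The second difficulty is
that errors of the order of the hyperbolicity constant could accumulate along chains of branch
points; the same separation prevents this. All estimates use Gromov's four-point condition
(`IsHyperbolic.fourPoint`) in place of geodesic triangles.
-/

namespace MagicWPD

/-! ### The four-point condition -/

section FourPoint

variable {X : Type*} [MetricSpace X]

/-- Gromov's four-point condition with constant `δ`. -/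
def FourPoint (X : Type*) [MetricSpace X] (δ : ℝ) : Prop :=
  ∀ o x y z : X, min (gromovProduct o x y) (gromovProduct o y z) ≤ gromovProduct o x z + δ

lemma gromovProduct_comm (o x y : X) : gromovProduct o x y = gromovProduct o y x := by
  simp only [gromovProduct, dist_comm x y]; ring

namespace IsGeodesicSegment

variable {s : Set X} {x y : X}

lemma dist_add_dist (h : IsGeodesicSegment s x y) {u : X} (hu : u ∈ s) :
    dist x u + dist u y = dist x y := by
  obtain ⟨γ, h0, h1, hγ, rfl⟩ := h
  obtain ⟨t, ht, rfl⟩ := hu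
  have e1 := hγ 0 ⟨le_rfl, dist_nonneg⟩ t ht
  have e2 := hγ t ht (dist x y) ⟨dist_nonneg, le_rfl⟩
  rw [h0, zero_sub, abs_neg, abs_of_nonneg ht.1] at e1
  rw [h1, abs_of_nonpos (by linarith [ht.2])] at e2
  linarith

lemma left_mem (h : IsGeodesicSegment s x y) : x ∈ s := by
  obtain ⟨γ, h0, h1, hγ, rfl⟩ := h
  exact ⟨0, ⟨le_rfl, dist_nonneg⟩, h0⟩

lemma right_mem (h : IsGeodesicSegment s x y) : y ∈ s := by
  obtain ⟨γ, h0, h1, hγ, rfl⟩ := h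
  exact ⟨dist x y, ⟨dist_nonneg, le_rfl⟩, h1⟩

lemma exists_continuousOn (h : IsGeodesicSegment s x y) :
    ∃ γ : ℝ → X, ContinuousOn γ (Set.Icc 0 (dist x y)) ∧ s = γ '' Set.Icc 0 (dist x y) := by
  obtain ⟨γ, h0, h1, hγ, hs⟩ := h
  refine ⟨γ, ?_, hs⟩
  refine LipschitzOnWith.continuousOn (K := 1) (LipschitzOnWith.of_dist_le_mul ?_)
  intro t ht t' ht'
  rw [hγ t ht t' ht', Real.dist_eq]; simp

lemma isCompact (h : IsGeodesicSegment s x y) : IsCompact s := by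
  obtain ⟨γ, hc, rfl⟩ := h.exists_continuousOn
  exact isCompact_Icc.image_of_continuousOn hc

lemma isPreconnected (h : IsGeodesicSegment s x y) : IsPreconnected s := by
  obtain ⟨γ, hc, rfl⟩ := h.exists_continuousOn
  exact isPreconnected_Icc.image γ hc

end IsGeodesicSegment

lemma isClosed_nbhd {s : Set X} (hs : IsCompact s) (hne : s.Nonempty) (R : ℝ) :
    IsClosed (nbhd R s) := by
  have : nbhd R s = {x | Metric.infDist x s ≤ R} := by
    ext x
    constructor
    · rintro ⟨a, ha, hd⟩
      exact (Metric.infDist_le_dist_of_mem ha).trans (by rwa [dist_comm])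
    · intro hx
      obtain ⟨a, ha, hd⟩ := hs.exists_infDist_eq_dist hne x
      exact ⟨a, ha, by rw [dist_comm, ← hd]; exact hx⟩
  rw [this]
  exact isClosed_le (Metric.continuous_infDist_pt s) continuous_const

lemma gromovProduct_le_dist {s : Set X} {x z : X} (h : IsGeodesicSegment s x z) (w : X) {p : X}
    (hp : p ∈ s) : gromovProduct w x z ≤ dist w p := by
  have := h.dist_add_dist hp
  have h1 := dist_triangle w p x
  have h2 := dist_triangle w p z
  rw [dist_comm p x] at h1
  unfold gromovProduct
  linarith

/-- In a thin triangle some point of the side `[x, z]` is close to both other sides, by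
connectedness of `[x, z]`; the Gromov product `(x | z)_w` is almost its distance to `w`. -/
lemma exists_dist_le_gromovProduct {δ : ℝ} (hgeod : IsGeodesicSpace X) (hhyp : IsHyperbolic X δ)
    (w x z : X) {s : Set X} (hs : IsGeodesicSegment s x z) (hδ : 0 ≤ δ) :
    ∃ p ∈ s, dist w p ≤ gromovProduct w x z + 2 * δ := by
  obtain ⟨s₁, h₁⟩ := hgeod x w
  obtain ⟨s₂, h₂⟩ := hgeod w z
  have hcov := hhyp x w z s₁ s₂ s h₁ h₂ hs
  obtain ⟨p, hp, ⟨u, hu, hpu⟩, ⟨v, hv, hpv⟩⟩ :=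
    isPreconnected_closed_iff.1 hs.isPreconnected _ _
      (isClosed_nbhd h₁.isCompact ⟨x, h₁.left_mem⟩ δ)
      (isClosed_nbhd h₂.isCompact ⟨w, h₂.left_mem⟩ δ) hcov
      ⟨x, hs.left_mem, x, h₁.left_mem, by simpa using hδ⟩
      ⟨z, hs.right_mem, z, h₂.right_mem, by simpa using hδ⟩
  refine ⟨p, hp, ?_⟩
  have e := hs.dist_add_dist hp
  have e1 := h₁.dist_add_dist hu
  have e2 := h₂.dist_add_dist hv
  have t1 := dist_triangle x u p
  have t2 := dist_triangle w u p
  have t3 := dist_triangle w v p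
  have t4 := dist_triangle p v z
  rw [dist_comm p v] at t4
  rw [dist_comm u w, dist_comm x w] at e1
  unfold gromovProduct
  linarith

lemma IsHyperbolic.fourPoint {δ : ℝ} (hδ : 0 ≤ δ) (hgeod : IsGeodesicSpace X)
    (hhyp : IsHyperbolic X δ) : FourPoint X (3 * δ) := by
  intro o x y z
  obtain ⟨s, hs⟩ := hgeod x z
  obtain ⟨s₁, h₁⟩ := hgeod x y
  obtain ⟨s₂, h₂⟩ := hgeod y z
  obtain ⟨p, hp, hd⟩ := exists_dist_le_gromovProduct hgeod hhyp o x z hs hδ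
  rcases hhyp x y z s₁ s₂ s h₁ h₂ hs hp with ⟨u, hu, hpu⟩ | ⟨u, hu, hpu⟩
  · have h := gromovProduct_le_dist h₁ o hu
    have t := dist_triangle o p u
    rw [dist_comm p u] at t
    exact (min_le_left _ _).trans (by linarith)
  · have h := gromovProduct_le_dist h₂ o hu
    have t := dist_triangle o p u
    rw [dist_comm p u] at t
    exact (min_le_right _ _).trans (by linarith)

lemma FourPoint.le_gromovProduct {δ : ℝ} (h : FourPoint X δ) {o x y z : X} {c : ℝ}
    (h1 : c ≤ gromovProduct o x y) (h2 : c ≤ gromovProduct o y z) :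
    c - δ ≤ gromovProduct o x z := by
  have := h o x y z
  have := le_min h1 h2
  linarith

/-- The four-point condition as a comparison of the three sums of opposite distances. -/
lemma FourPoint.dist_add_dist_le {δ : ℝ} (h : FourPoint X δ) (x y z w : X) :
    dist x y + dist z w ≤ dist x z + dist y w + 2 * δ ∨
      dist x y + dist z w ≤ dist x w + dist y z + 2 * δ := by
  have := h x z y w
  simp only [gromovProduct] at this
  rw [dist_comm z y] at this
  rcases min_le_iff.1 this with h | h
  · right; linarith
  · left; linarith

end FourPoint

/-! ### Projections to a geodesic line -/

section Projection

variable {X : Type*} [MetricSpace X] {δ : ℝ}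

/-- A nearest point `y` on a line lies, up to `4 * δ`, on the way from `x` to every other point
of the line. -/
lemma dist_add_dist_le_of_mem_proj (h4 : FourPoint X δ) {l : ℝ → X} (hl : Isometry l) {x : X}
    {s : ℝ} (hs : l s ∈ proj (Set.range l) x) (t : ℝ) :
    dist x (l s) + |s - t| ≤ dist x (l t) + 4 * δ := by
  have hst : dist (l s) (l t) = |s - t| := by rw [hl.dist_eq, Real.dist_eq]
  have ht1 := dist_triangle x (l s) (l t)
  have ht2 := dist_triangle x (l t) (l s)
  have ht3 := dist_triangle (l s) x (l t)
  rw [dist_comm (l t) (l s), hst] at ht2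
  rw [dist_comm (l s) x, hst] at ht3
  rw [hst] at ht1
  -- the point of the line between `l s` and `l t` at distance `(x | l t)_{l s}` from `l s`
  obtain ⟨r, hr1, hr2⟩ : ∃ r, |s - r| = (dist x (l s) + |s - t| - dist x (l t)) / 2 ∧
      |r - t| = (dist x (l t) + |s - t| - dist x (l s)) / 2 := by
    rcases le_total s t with hle | hle
    · have habs : |s - t| = t - s := by rw [abs_of_nonpos (by linarith)]; ring
      rw [habs] at ht1 ht2 ht3 ⊢
      refine ⟨s + (dist x (l s) + (t - s) - dist x (l t)) / 2, ?_, ?_⟩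
      · rw [abs_of_nonpos (by linarith)]; ring
      · rw [abs_of_nonpos (by linarith)]; ring
    · have habs : |s - t| = s - t := abs_of_nonneg (by linarith)
      rw [habs] at ht1 ht2 ht3 ⊢
      refine ⟨s - (dist x (l s) + (s - t) - dist x (l t)) / 2, ?_, ?_⟩
      · rw [abs_of_nonneg (by linarith)]; ring
      · rw [abs_of_nonneg (by linarith)]; ring
  have hmin := hs.2 (l r) ⟨r, rfl⟩
  have h := h4.dist_add_dist_le x (l r) (l s) (l t)
  rw [hst, hl.dist_eq, Real.dist_eq, hl.dist_eq, Real.dist_eq, abs_sub_comm r s] at h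
  rcases h with h | h <;> linarith

/-- If the projections of `x` and `y` to a line are far apart, then a geodesic from `x` to `y`
runs along the line between them. -/
lemma dist_add_dist_add_dist_le (h4 : FourPoint X δ) {l : ℝ → X} (hl : Isometry l) {x y : X}
    {s t : ℝ} (hs : l s ∈ proj (Set.range l) x) (ht : l t ∈ proj (Set.range l) y)
    (hst : 5 * δ < |s - t|) :
    dist x (l s) + |s - t| + dist (l t) y ≤ dist x y + 10 * δ := by
  have h1 := dist_add_dist_le_of_mem_proj h4 hl hs t
  have h2 := dist_add_dist_le_of_mem_proj h4 hl ht s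
  rw [abs_sub_comm t s] at h2
  have h := h4.dist_add_dist_le x (l t) y (l s)
  rw [hl.dist_eq, Real.dist_eq, abs_sub_comm t s] at h
  rw [dist_comm (l t) y] at *
  rcases h with h | h <;> linarith

lemma exists_mem_proj_of_le_projDist (h4 : FourPoint X δ) {l : ℝ → X} (hl : Isometry l) {x y : X}
    {c c' : ℝ} (hc : 4 * δ ≤ c) (hc0 : 0 ≤ c) (hcc : c < c')
    (h : c' ≤ projDist (Set.range l) x y) :
    ∃ s t, l s ∈ proj (Set.range l) x ∧ l t ∈ proj (Set.range l) y ∧ c < |s - t| := by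
  have key : ∀ z : X, ∀ s t, l s ∈ proj (Set.range l) z → l t ∈ proj (Set.range l) z →
      |s - t| ≤ c := by
    intro z s t hs ht
    have h1 := dist_add_dist_le_of_mem_proj h4 hl hs t
    have h2 := ht.2 (l s) ⟨s, rfl⟩
    linarith
  by_contra! hcon
  refine absurd (h.trans (Metric.diam_le_of_forall_dist_le hc0 ?_)) (not_le.2 hcc)
  intro u hu v hv
  have hu' : u ∈ Set.range l := hu.elim (fun h => h.1) (fun h => h.1)
  have hv' : v ∈ Set.range l := hv.elim (fun h => h.1) (fun h => h.1)
  obtain ⟨s, rfl⟩ := hu'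
  obtain ⟨t, rfl⟩ := hv'
  rw [hl.dist_eq, Real.dist_eq]
  rcases hu with hu | hu <;> rcases hv with hv | hv
  · exact key _ _ _ hu hv
  · exact hcon _ _ hu hv
  · rw [abs_sub_comm]; exact hcon _ _ hv hu
  · exact key _ _ _ hu hv

end Projection

/-! ### Independent subsets -/

section Combinatorics

open Finset

/-- A relation whose out-degrees on `B` are at most `K` has a vertex of total degree at most
`2 * K`, so a greedy choice produces a large independent subset. -/
lemma exists_independent_subset {α : Type*} (r : α → α → Prop) (K : ℕ) (B : Finset α)
    (hr : ∀ a ∈ B, {a' ∈ (B : Set α) | r a a'}.ncard ≤ K) :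
    ∃ C ⊆ B, B.card ≤ (2 * K + 1) * C.card ∧ ∀ a ∈ C, ∀ a' ∈ C, a ≠ a' → ¬ r a a' := by
  classical
  have hr' : ∀ a ∈ B, #{a' ∈ B | r a a'} ≤ K := by
    intro a ha
    have := hr a ha
    rwa [show {a' ∈ (B : Set α) | r a a'} = ↑({a' ∈ B | r a a'}) by ext; simp,
      Set.ncard_coe_finset] at this
  clear hr
  induction B using Finset.strongInduction with
  | H B ih =>
  rcases B.eq_empty_or_nonempty with rfl | hne
  · exact ⟨∅, by simp⟩
  obtain ⟨a, haB, ha⟩ : ∃ a ∈ B, #{a' ∈ B | r a' a} ≤ K := by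
    by_contra! hcon
    have h1 : ∑ a ∈ B, #{a' ∈ B | r a a'} = ∑ a ∈ B, #{a' ∈ B | r a' a} :=
      Finset.sum_card_bipartiteAbove_eq_sum_card_bipartiteBelow r
    have h2 : ∑ a ∈ B, #{a' ∈ B | r a a'} ≤ ∑ a ∈ B, K := Finset.sum_le_sum hr'
    have h3 : ∑ a ∈ B, K < ∑ a ∈ B, #{a' ∈ B | r a' a} :=
      Finset.sum_lt_sum_of_nonempty hne hcon
    omega
  set M := insert a ({a' ∈ B | r a' a} ∪ {a' ∈ B | r a a'}) with hM
  have hMB : M ⊆ B := by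
    intro x hx
    simp only [hM, mem_insert, mem_union, mem_filter] at hx
    rcases hx with rfl | hx | hx
    · exact haB
    · exact hx.1
    · exact hx.1
  have hMc : #M ≤ 2 * K + 1 := by
    have h1 := card_insert_le a ({a' ∈ B | r a' a} ∪ {a' ∈ B | r a a'})
    have h2 := card_union_le {a' ∈ B | r a' a} {a' ∈ B | r a a'}
    have h3 := hr' a haB
    rw [hM]
    omega
  have hss : B \ M ⊂ B := Finset.sdiff_ssubset hMB ⟨a, by simp [hM]⟩
  obtain ⟨C, hCB, hcard, hC⟩ := ih (B \ M) hss (fun x hx => by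
    refine (card_le_card ?_).trans (hr' x (sdiff_subset hx))
    exact filter_subset_filter _ sdiff_subset)
  have haC : a ∉ C := fun h => (mem_sdiff.1 (hCB h)).2 (by simp [hM])
  have hout : ∀ x ∈ C, ¬ r a x ∧ ¬ r x a := by
    intro x hx
    have h1 := mem_sdiff.1 (hCB hx)
    simp only [hM, mem_insert, mem_union, mem_filter, not_or, not_and] at h1
    exact ⟨h1.2.2.2 h1.1, h1.2.2.1 h1.1⟩
  refine ⟨insert a C, ?_, ?_, ?_⟩
  · intro x hx
    rcases mem_insert.1 hx with rfl | hx
    · exact haB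
    · exact sdiff_subset (hCB hx)
  · rw [card_insert_of_notMem haC]
    have := card_sdiff_add_card_eq_card hMB
    nlinarith
  · intro x hx y hy hxy
    rcases mem_insert.1 hx with hxa | hx <;> rcases mem_insert.1 hy with hya | hy
    · exact absurd (hxa.trans hya.symm) hxy
    · exact hxa ▸ (hout y hy).1
    · exact hya ▸ (hout x hx).2
    · exact hC x hx y hy hxy

/-- If no three elements are pairwise unrelated, then two elements dominate all others. -/
lemma exists_two_dominating {α : Type*} [Nonempty α] (s : Set α) (r : α → α → Prop)
    (hs : ∀ a b, r a b → r b a)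
    (h : ∀ a ∈ s, ∀ b ∈ s, ∀ c ∈ s, r a b ∨ r a c ∨ r b c ) :
    ∃ a b, ∀ c ∈ s, r c a ∨ r c b := by
  by_cases hne : ∃ a ∈ s, ∃ b ∈ s, ¬ r a b
  · obtain ⟨a, ha, b, hb, hab⟩ := hne
    refine ⟨a, b, fun c hc => ?_⟩
    rcases h a ha b hb c hc with h | h | h
    · exact absurd h hab
    · exact Or.inl (hs _ _ h)
    · exact Or.inr (hs _ _ h)
  · push Not at hne
    by_cases he : s.Nonempty
    · obtain ⟨a, ha⟩ := he
      exact ⟨a, a, fun c hc => Or.inl (hne c hc a ha)⟩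
    · obtain ⟨a⟩ := ‹Nonempty α›
      exact ⟨a, a, fun c hc => absurd ⟨c, hc⟩ he⟩

end Combinatorics

/-! ### Counting branch points -/

section Counting

open Finset

variable {X : Type*} [MetricSpace X] {δ D : ℝ}

lemma gromovProduct_le_left (o x y : X) : gromovProduct o x y ≤ dist o x := by
  have := dist_triangle o x y
  unfold gromovProduct
  linarith

/-- Branch points `y a`, each with two branches ending at `q a true` and `q a false` as seen from
the root `o`, are few if the branches are heavy: the set `P a i` of the points of `A` behind
`q a i` has at least `N` elements.

Picture the root at the bottom. A branch `(a', i')` is below `a` when `q a' i'` lies on the way from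
`o` to `y a`, and the parent of `a` is the highest branch below it, the one with `y a'` farthest from
`o`. As there are twice as many branches as branch points, at least `#B` branches are not parents.
The sets `P` of these are disjoint: if `P a i` and `P a' i'` have a common point `b` and `y a` is
higher than `y a'`, then `(a', i')` is the parent of the lowest branch point above `y a'` on the way
from `o` to `z b`. The separation hypothesis lets the errors of the four-point condition be
absorbed in the gap between different branch points. -/
lemma card_mul_le_of_branching {E₁ : ℝ} (h4 : FourPoint X δ) (hδ : 0 ≤ δ) (hD0 : 0 < D)
    (hD : 100 * δ ≤ D) (o : X) {ι β : Type*} (B : Finset ι) (A : Finset β) (y : ι → X)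
    (q : ι → Bool → X) (P : ι → Bool → Finset β) (z : β → X) (N : ℕ)
    (hPA : ∀ a ∈ B, ∀ i, P a i ⊆ A) (hN : ∀ a ∈ B, ∀ i, N ≤ #(P a i))
    (hyq : ∀ a ∈ B, ∀ i, dist o (y a) + 94 * D ≤ dist o (q a i))
    (hqy : ∀ a ∈ B, ∀ i, dist o (q a i) ≤ dist o (y a) + E₁)
    (hqq : ∀ a ∈ B, gromovProduct o (q a true) (q a false) ≤ dist o (y a) + 2 * D)
    (hqz : ∀ a ∈ B, ∀ i, ∀ b ∈ P a i, dist o (q a i) - 6 * δ ≤ gromovProduct o (q a i) (z b))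
    (hyz : ∀ a ∈ B, ∀ i, ∀ b ∈ P a i, dist o (y a) - 4 * D ≤ gromovProduct o (y a) (z b))
    (hyq' : ∀ a ∈ B, ∀ i, dist o (y a) - 3 * D ≤ gromovProduct o (y a) (q a i))
    (hsep : ∀ a ∈ B, ∀ a' ∈ B, a ≠ a' → ∀ i i',
      min (dist o (q a i)) (dist o (q a' i')) - 8 * δ ≤ gromovProduct o (q a i) (q a' i') →
      E₁ + 4 * D < |dist o (y a) - dist o (y a')|) :
    #B * N ≤ #A := by
  classical
  have hqq' : ∀ a ∈ B, ∀ i i', i ≠ i' →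
      gromovProduct o (q a i) (q a i') ≤ dist o (y a) + 2 * D := by
    intro a ha i i' hi
    cases i <;> cases i'
    · exact absurd rfl hi
    · rw [gromovProduct_comm]; exact hqq a ha
    · exact hqq a ha
    · exact absurd rfl hi
  let Sl : Finset (ι × Bool) := B ×ˢ univ
  have hSl : ∀ s, s ∈ Sl ↔ s.1 ∈ B := fun s => by simp [Sl]
  let Below : ι → ι × Bool → Prop := fun a s =>
    dist o (q s.1 s.2) - 7 * δ ≤ gromovProduct o (y a) (q s.1 s.2)
  have hπ : ∀ a, ∃ s, ∀ s' ∈ Sl, Below a s' →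
      s ∈ Sl ∧ Below a s ∧ dist o (y s'.1) ≤ dist o (y s.1) := by
    intro a
    rcases (Sl.filter (Below a)).eq_empty_or_nonempty with h | h
    · refine ⟨(a, true), fun s' hs' hb => ?_⟩
      have : s' ∈ Sl.filter (Below a) := mem_filter.2 ⟨hs', hb⟩
      rw [h] at this
      exact absurd this (notMem_empty _)
    · obtain ⟨s, hs, hmax⟩ := exists_max_image _ (fun s => dist o (y s.1)) h
      refine ⟨s, fun s' hs' hb => ⟨(mem_filter.1 hs).1, (mem_filter.1 hs).2, ?_⟩⟩
      exact hmax s' (mem_filter.2 ⟨hs', hb⟩)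
  choose π hπ using hπ
  -- two branches sharing a point: the one whose branch point is closer to the root is a parent
  have key : ∀ s ∈ Sl, ∀ s' ∈ Sl, s.1 ≠ s'.1 → dist o (y s'.1) ≤ dist o (y s.1) →
      ∀ b ∈ P s.1 s.2, b ∈ P s'.1 s'.2 → s' ∈ B.image π := by
    intro s hs s' hs' hne hle b hb hb'
    have hsB := (hSl s).1 hs
    have hsB' := (hSl s').1 hs'
    have hb1 := hqz _ hsB _ b hb
    have hb1' := hqz _ hsB' _ b hb'
    have hgap : dist o (y s'.1) + (E₁ + 4 * D) < dist o (y s.1) := by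
      have := hsep _ hsB _ hsB' hne s.2 s'.2 (by
        have := h4.le_gromovProduct (o := o) (x := q s.1 s.2) (y := z b) (z := q s'.1 s'.2)
          (c := min (dist o (q s.1 s.2)) (dist o (q s'.1 s'.2)) - 6 * δ)
          (by linarith [min_le_left (dist o (q s.1 s.2)) (dist o (q s'.1 s'.2))])
          (by rw [gromovProduct_comm]
              linarith [min_le_right (dist o (q s.1 s.2)) (dist o (q s'.1 s'.2))])
        linarith)
      rw [abs_of_nonneg (by linarith)] at this
      linarith
    let Z := B.filter fun a => dist o (y s'.1) + (E₁ + 4 * D) < dist o (y a) ∧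
      dist o (y a) - 4 * D ≤ gromovProduct o (y a) (z b)
    have hZ : Z.Nonempty := ⟨s.1, mem_filter.2 ⟨hsB, hgap, hyz _ hsB _ b hb⟩⟩
    obtain ⟨a, haZ, hmin⟩ := exists_min_image Z (fun a => dist o (y a)) hZ
    obtain ⟨haB, ha1, ha2⟩ := mem_filter.1 haZ
    have hq1 := hqy _ hsB' s'.2
    have hbel : Below a s' := by
      have := h4.le_gromovProduct (o := o) (x := y a) (y := z b) (z := q s'.1 s'.2)
        (c := dist o (q s'.1 s'.2) - 6 * δ) (by linarith) (by rw [gromovProduct_comm]; exact hb1')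
      change _ ≤ _
      linarith
    obtain ⟨hπS, hπb, hπd⟩ := hπ a s' hs' hbel
    have hπB := (hSl _).1 hπS
    set t := π a with ht
    have hπb' : dist o (q t.1 t.2) - 7 * δ ≤ gromovProduct o (y a) (q t.1 t.2) := hπb
    have hbel' : dist o (q s'.1 s'.2) - 7 * δ ≤ gromovProduct o (y a) (q s'.1 s'.2) := hbel
    have hqt : min (dist o (q t.1 t.2)) (dist o (q s'.1 s'.2)) - 8 * δ
        ≤ gromovProduct o (q t.1 t.2) (q s'.1 s'.2) := by
      have := h4.le_gromovProduct (o := o) (x := q t.1 t.2) (y := y a) (z := q s'.1 s'.2)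
        (c := min (dist o (q t.1 t.2)) (dist o (q s'.1 s'.2)) - 7 * δ)
        (by rw [gromovProduct_comm]
            linarith [min_le_left (dist o (q t.1 t.2)) (dist o (q s'.1 s'.2))])
        (by linarith [min_le_right (dist o (q t.1 t.2)) (dist o (q s'.1 s'.2))])
      linarith
    have hyt := hyq _ hπB t.2
    have hys := hyq _ hsB' s'.2
    by_cases h1 : t.1 = s'.1
    · by_cases h2 : t.2 = s'.2
      · exact mem_image.2 ⟨a, haB, Prod.ext h1 h2⟩
      · exfalso
        have h3 := hqq' _ hsB' _ _ h2
        rw [h1] at hqt hyt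
        have := le_min hyt hys
        linarith
    · exfalso
      have hgap' := hsep _ hπB _ hsB' h1 _ _ hqt
      rw [abs_of_nonneg (by linarith)] at hgap'
      -- the parent would be a lower element of `Z` than `a`
      have hlt : dist o (y t.1) + 93 * D ≤ dist o (y a) := by
        have := gromovProduct_le_left o (y a) (q t.1 t.2)
        linarith
      have hyqt := hyq' _ hπB t.2
      have e1 := h4.le_gromovProduct (o := o) (x := y t.1) (y := q t.1 t.2) (z := y a)
        (c := dist o (y t.1) - 3 * D) hyqt (by rw [gromovProduct_comm]; linarith)
      have e2 := h4.le_gromovProduct (o := o) (x := y t.1) (y := y a) (z := z b)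
        (c := dist o (y t.1) - 3 * D - δ) e1 (by linarith)
      have := hmin t.1 (mem_filter.2 ⟨hπB, by linarith, by linarith⟩)
      linarith
  let U := Sl \ B.image π
  have hU : #B ≤ #U := by
    have h1 : #Sl = #B * 2 := by simp [Sl, card_product]
    have h2 : #(B.image π) ≤ #B := card_image_le
    have h3 := le_card_sdiff (B.image π) Sl
    change _ ≤ #(Sl \ B.image π)
    omega
  have hdisj : ∀ s ∈ U, ∀ s' ∈ U, s ≠ s' → Disjoint (P s.1 s.2) (P s'.1 s'.2) := by
    intro s hs s' hs' hne
    obtain ⟨hs1, hs2⟩ := mem_sdiff.1 hs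
    obtain ⟨hs1', hs2'⟩ := mem_sdiff.1 hs'
    rw [Finset.disjoint_left]
    intro b hb hb'
    by_cases h1 : s.1 = s'.1
    · have h2 : s.2 ≠ s'.2 := fun h2 => hne (Prod.ext h1 h2)
      have hB := (hSl s).1 hs1
      rw [← h1] at hb'
      have e1 := hqz _ hB _ b hb
      have e2 := hqz _ hB _ b hb'
      have e3 := hqq' _ hB _ _ h2
      have e4 := hyq _ hB s.2
      have e5 := hyq _ hB s'.2
      have := h4.le_gromovProduct (o := o) (x := q s.1 s.2) (y := z b) (z := q s.1 s'.2)
        (c := dist o (y s.1) + 94 * D - 6 * δ) (by linarith)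
        (by rw [gromovProduct_comm]; linarith)
      linarith
    · rcases le_total (dist o (y s'.1)) (dist o (y s.1)) with h | h
      · exact hs2' (key s hs1 s' hs1' h1 h b hb hb')
      · exact hs2 (key s' hs1' s hs1 (Ne.symm h1) h b hb' hb)
  calc #B * N ≤ #U * N := Nat.mul_le_mul_right _ hU
    _ ≤ ∑ s ∈ U, #(P s.1 s.2) := by
        rw [← smul_eq_mul]
        exact card_nsmul_le_sum _ _ _ fun s hs => hN _ ((hSl s).1 (mem_sdiff.1 hs).1) _
    _ = #(U.biUnion fun s => P s.1 s.2) := (card_biUnion hdisj).symm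
    _ ≤ #A := card_le_card <| biUnion_subset.2 fun s hs =>
        hPA _ ((hSl s).1 (mem_sdiff.1 hs).1) _

end Counting

/-! ### Directions along a line, seen from two basepoints -/

section Directions

variable {X : Type*} [MetricSpace X] {δ D : ℝ}

/-- For a point `x` projecting to `l 0`, the point `l u` lies on the way from `x` to every point
`z` that projects far beyond `l u`. -/
lemma dist_add_dist_le_of_far_projection (h4 : FourPoint X δ) (hD0 : 0 < D)
    (hD : 100 * δ ≤ D) {l : ℝ → X} (hl : Isometry l) {x z : X}
    (h0 : l 0 ∈ proj (Set.range l) x) {u s t : ℝ} (hu0 : 119 * D ≤ u) (hu : u ≤ 122 * D)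
    (hs : l s ∈ proj (Set.range l) x) (ht : l t ∈ proj (Set.range l) z)
    (hst : 249 * D ≤ t - s) :
    dist x (l u) + dist (l u) z ≤ dist x z + 10 * δ := by
  have h1 := dist_add_dist_le_of_mem_proj h4 hl hs 0
  have h2 := h0.2 (l s) ⟨s, rfl⟩
  have h3 : |s| ≤ 4 * δ := by rw [sub_zero] at h1; linarith
  have h3' := abs_le.1 h3
  have habs : |s - t| = t - s := by rw [abs_of_nonpos (by linarith)]; ring
  have h5 := dist_add_dist_add_dist_le h4 hl hs ht (by rw [habs]; linarith)
  have e1 : dist (l s) (l u) = u - s := by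
    rw [hl.dist_eq, Real.dist_eq, abs_of_nonpos (by linarith)]; ring
  have e2 : dist (l u) (l t) = t - u := by
    rw [hl.dist_eq, Real.dist_eq, abs_of_nonpos (by linarith)]; ring
  have t1 := dist_triangle x (l s) (l u)
  have t2 := dist_triangle (l u) (l t) z
  linarith

lemma le_dist_of_mem_proj_zero (h4 : FourPoint X δ) {l : ℝ → X} (hl : Isometry l) {x : X}
    (h0 : l 0 ∈ proj (Set.range l) x) (u : ℝ) : u - 4 * δ ≤ dist x (l u) := by
  have h1 := dist_add_dist_le_of_mem_proj h4 hl h0 u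
  have h2 : u ≤ |0 - u| := by rw [zero_sub, abs_neg]; exact le_abs_self u
  have h3 : 0 ≤ dist x (l 0) := dist_nonneg
  linarith

lemma dist_add_le_of_mem_proj_zero (h4 : FourPoint X δ) {l : ℝ → X} (hl : Isometry l) {x : X}
    (h0 : l 0 ∈ proj (Set.range l) x) {u L : ℝ} (hL : 0 ≤ L) (hu : L ≤ u) :
    dist x (l (u - L)) + L ≤ dist x (l u) + 4 * δ := by
  have h1 := dist_add_dist_le_of_mem_proj h4 hl h0 u
  rw [zero_sub, abs_neg, abs_of_nonneg (by linarith)] at h1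
  have e1 : dist (l 0) (l (u - L)) = u - L := by
    rw [hl.dist_eq, Real.dist_eq, zero_sub, abs_neg, abs_of_nonneg (by linarith)]
  have t1 := dist_triangle x (l 0) (l (u - L))
  linarith

/-! The next lemmas change the viewpoint from `y` to a root `o`. A bound on the Gromov product
`(o | q)_y` says that the geodesics from `y` to `o` and to `q` part early, so that a geodesic from
`o` to `q` passes near `y`. -/

lemma dist_add_le_of_gromovProduct_le {o y q : X} (h : gromovProduct y o q ≤ 3 * D)
    (hq : 100 * D ≤ dist y q) : dist o y + 94 * D ≤ dist o q := by
  unfold gromovProduct at h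
  rw [dist_comm y o] at h
  linarith

lemma le_gromovProduct_of_gromovProduct_le {c : ℝ} {o y q : X} (h : gromovProduct y o q ≤ c) :
    dist o y - c ≤ gromovProduct o y q := by
  unfold gromovProduct at *
  rw [dist_comm y o] at h
  linarith

lemma dist_add_le_of_segment (h4 : FourPoint X δ) (hD0 : 0 < D) (hD : 100 * δ ≤ D)
    {o y p q : X} {L : ℝ} (h : gromovProduct y o q ≤ 3 * D) (hp : 100 * D ≤ dist y p)
    (hpq : dist p q = L) (hypq : dist y p + L ≤ dist y q + 4 * δ) :
    dist o p + L ≤ dist o q + 6 * δ := by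
  unfold gromovProduct at h
  rw [dist_comm y o] at h
  have t := dist_triangle o p q
  rcases h4.dist_add_dist_le o p y q with h1 | h1
  · linarith
  · rw [dist_comm p y] at h1
    linarith

lemma le_gromovProduct_of_behind (h4 : FourPoint X δ) (hD0 : 0 < D) (hD : 100 * δ ≤ D)
    {o y q b : X} (h : gromovProduct y o q ≤ 3 * D) (hq : 100 * D ≤ dist y q)
    (hb : dist y q + dist q b ≤ dist y b + 10 * δ) :
    dist o q - 6 * δ ≤ gromovProduct o q b ∧ dist o y - 4 * D ≤ gromovProduct o y b := by
  have hle := dist_add_le_of_gromovProduct_le h hq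
  have t := dist_triangle y o q
  unfold gromovProduct at *
  rw [dist_comm y o] at *
  rcases h4.dist_add_dist_le o q y b with h1 | h1
  · constructor <;> linarith
  · rw [dist_comm q y] at h1
    constructor <;> linarith

lemma gromovProduct_le_of_tripod {o y q q' : X} (h : gromovProduct y q q' ≤ 2 * D) :
    gromovProduct o q q' ≤ dist o y + 2 * D := by
  have t := dist_triangle o y q
  have t' := dist_triangle o y q'
  unfold gromovProduct at *
  linarith

/-- Two segments `[p, q]` and `[p', q']` of length `L` along which geodesics from `o` run, with
endpoints `q` and `q'` at almost the same distance from `o` on the way to `z`, are close. -/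
lemma dist_lt_of_segments (h4 : FourPoint X δ) (hδ : 0 ≤ δ) {o z p q p' q' : X} {L c : ℝ}
    (hL : 0 ≤ L) (hpq : dist p q = L) (hpq' : dist p' q' = L)
    (h : dist o p + L ≤ dist o q + 6 * δ) (h' : dist o p' + L ≤ dist o q' + 6 * δ)
    (hz : dist o q - 8 * δ ≤ gromovProduct o z q) (hz' : dist o q' - 8 * δ ≤ gromovProduct o z q')
    (hc : c ≤ dist o q) (hc1 : dist o q ≤ c + 1) (hc' : c ≤ dist o q') (hc1' : dist o q' ≤ c + 1) :
    dist p p' < 50 * δ + 3 ∧ dist q q' < 50 * δ + 3 := by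
  have t := dist_triangle o p q
  have t' := dist_triangle o p' q'
  have hqq := h4.le_gromovProduct (o := o) (x := q) (y := z) (z := q') (c := c - 8 * δ)
    (by rw [gromovProduct_comm]; linarith) (by linarith)
  have hp : c - L - 3 * δ ≤ gromovProduct o p q := by unfold gromovProduct; linarith
  have hp' : c - L - 3 * δ ≤ gromovProduct o q' p' := by
    unfold gromovProduct; rw [dist_comm q' p']; linarith
  have e1 := h4.le_gromovProduct (o := o) (x := p) (y := q) (z := q') (c := c - L - 9 * δ)
    (by linarith) (by linarith)
  have e2 := h4.le_gromovProduct (o := o) (x := p) (y := q') (z := p') (c := c - L - 10 * δ)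
    (by linarith) (by linarith)
  unfold gromovProduct at hqq e2
  constructor <;> linarith

end Directions

/-! ### Word balls and weak proper discontinuity -/

section Group

variable {G : Type*} [Group G]

lemma finite_setOf_wordNorm_le {S : Set G} (hS : S.Finite) (hgen : Subgroup.closure S = ⊤)
    (c : ℝ) : {g : G | (wordNorm S g : ℝ) ≤ c}.Finite := by
  have hfin : Finite ↥(S ∪ S⁻¹) := (hS.union hS.inv).to_subtype
  refine ((List.finite_length_le ↥(S ∪ S⁻¹) ⌊c⌋₊).image
    fun l => (l.map Subtype.val).prod).subset ?_
  intro g hg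
  have hne : {n : ℕ | ∃ l : List G, l.length = n ∧ (∀ s ∈ l, s ∈ S ∪ S⁻¹) ∧
      l.prod = g}.Nonempty := by
    have hg' : g ∈ (Subgroup.closure S).toSubmonoid := by rw [hgen]; trivial
    rw [Subgroup.closure_toSubmonoid] at hg'
    obtain ⟨l, hl, hp⟩ := Submonoid.exists_list_of_mem_closure hg'
    exact ⟨_, l, rfl, hl, hp⟩
  obtain ⟨l, hlen, hl, hp⟩ := Nat.sInf_mem hne
  refine ⟨l.attach.map fun x => ⟨x.1, hl x.1 x.2⟩, ?_, ?_⟩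
  · simp only [Set.mem_ofPred_eq, List.length_map, List.length_attach]
    rw [hlen]
    exact Nat.le_floor hg
  · simp [List.map_map, Function.comp_def, hp]

variable {X : Type*} [MetricSpace X] [MulAction G X]

lemma IsUnitalAxis.zpow_smul {f : G} {γ : ℝ → X} (h : IsUnitalAxis f γ) (n : ℤ) (t : ℝ) :
    f ^ n • γ t = γ (t + n) := by
  induction n using Int.induction_on generalizing t with
  | zero => simp
  | succ n ih =>
    rw [zpow_add_one, mul_smul, h.2, ih]
    congr 1; push_cast; ring
  | pred n ih =>
    have h1 : f⁻¹ • γ t = γ (t - 1) := by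
      rw [inv_smul_eq_iff, h.2, sub_add_cancel]
    rw [zpow_sub_one, mul_smul, h1, ih]
    congr 1; push_cast; ring

variable [IsIsometricSMul G X]

lemma gromovProduct_smul (g : G) (o x y : X) :
    gromovProduct (g • o) (g • x) (g • y) = gromovProduct o x y := by
  simp only [gromovProduct, dist_smul]

/-- Weak proper discontinuity, applied to the segments in both directions of the axis. -/
lemma IsWPD.exists_finite {f : G} {x₀ : X} (h : IsWPD f x₀) {R : ℝ} (hR : 0 < R) :
    ∃ L : ℕ, ∀ σ : ℤˣ, {g : G | dist x₀ (g • x₀) < R ∧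
      dist (f ^ ((σ : ℤ) * L) • x₀) (g • f ^ ((σ : ℤ) * L) • x₀) < R}.Finite := by
  obtain ⟨L, -, hL⟩ := h R hR
  refine ⟨L, fun σ => ?_⟩
  rcases Int.units_eq_one_or σ with rfl | rfl
  · simpa using hL
  · refine (hL.image fun g => (f ^ L)⁻¹ * g * f ^ L).subset ?_
    rintro g ⟨h1, h2⟩
    refine ⟨f ^ L * g * (f ^ L)⁻¹, ⟨?_, ?_⟩, by group⟩
    · rw [← dist_smul ((f ^ L)⁻¹)]
      simpa [mul_smul] using h2
    · simpa [mul_smul] using h1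

/-- The translates by `T` of a segment of length `L` that lie at almost the same place on the way
from `o` to `z` are as few as the elements almost fixing the segment. -/
lemma card_le_of_segments {δ : ℝ} (h4 : FourPoint X δ) (hδ : 0 ≤ δ) {x₀ : X} (e : G) {L : ℝ}
    (hL : dist x₀ (e • x₀) = L)
    (hW : {g : G | dist x₀ (g • x₀) < 50 * δ + 3 ∧
      dist (e • x₀) (g • e • x₀) < 50 * δ + 3}.Finite)
    (o z : X) (v : G) (c : ℝ) (T : Finset G)
    (hT : ∀ a ∈ T, dist o ((a * v) • x₀) + L ≤ dist o ((a * v) • e • x₀) + 6 * δ ∧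
      dist o ((a * v) • e • x₀) - 8 * δ ≤ gromovProduct o z ((a * v) • e • x₀) ∧
      c ≤ dist o ((a * v) • e • x₀) ∧ dist o ((a * v) • e • x₀) ≤ c + 1) :
    T.card ≤ {g : G | dist x₀ (g • x₀) < 50 * δ + 3 ∧
      dist (e • x₀) (g • e • x₀) < 50 * δ + 3}.ncard := by
  rcases T.eq_empty_or_nonempty with rfl | ⟨a, ha⟩
  · simp
  rw [← Set.ncard_coe_finset]
  refine Set.ncard_le_ncard_of_injOn (fun a' => (a * v)⁻¹ * (a' * v)) ?_ ?_ hW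
  · intro a' ha'
    obtain ⟨h1, h2, h3, h5⟩ := hT a ha
    obtain ⟨h1', h2', h3', h5'⟩ := hT a' ha'
    obtain ⟨k1, k2⟩ := dist_lt_of_segments h4 hδ (hL ▸ dist_nonneg)
      (by rw [dist_smul, hL]) (by rw [dist_smul, hL]) h1 h1' h2 h2' h3 h5 h3' h5'
    constructor
    · rw [← dist_smul (a * v), smul_smul, mul_inv_cancel_left]
      exact k1
    · rw [← dist_smul (a * v), smul_smul (a * v) ((a * v)⁻¹ * _), mul_inv_cancel_left]
      exact k2
  · intro a' _ a'' _ h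
    simpa using h

end Group

/-! ### Directions of branching at a group element -/

lemma range_smul_line {G X : Type*} [Group G] [MulAction G X] (γ : ℝ → X) (h : G) (c : ℝ) (σ : ℤˣ) :
    Set.range (fun r : ℝ => h • γ (c + ((σ : ℤ) : ℝ) * r)) = h • Set.range γ := by
  ext x
  simp only [Set.mem_range, Set.mem_smul_set]
  constructor
  · rintro ⟨r, rfl⟩; exact ⟨_, ⟨_, rfl⟩, rfl⟩
  · rintro ⟨_, ⟨r, rfl⟩, rfl⟩
    refine ⟨(σ : ℤ) * (r - c), ?_⟩
    rcases Int.units_eq_one_or σ with rfl | rfl <;> simp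

section Branching

variable {G X : Type*} [Group G] [MetricSpace X] [MulAction G X]

/-- A parameter at which the translate by `h` of the line `γ` has a point nearest to `x₀`, with
value `0` if there is none. -/
noncomputable def projParam (γ : ℝ → X) (x₀ : X) (h : G) : ℝ :=
  open Classical in
  if H : ∃ s, h • γ s ∈ proj (h • Set.range γ) x₀ then H.choose else 0

lemma smul_projParam_mem {γ : ℝ → X} {x₀ : X} {h : G} {s : ℝ}
    (hs : h • γ s ∈ proj (h • Set.range γ) x₀) :
    h • γ (projParam γ x₀ h) ∈ proj (h • Set.range γ) x₀ := by
  have H : ∃ s, h • γ s ∈ proj (h • Set.range γ) x₀ := ⟨s, hs⟩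
  rw [projParam, dif_pos H]
  exact H.choose_spec

/-- The elements `g` for which the projections of `x₀` and `g • x₀` to the translate of the axis
by `ω.1` are far apart, that of `g • x₀` lying on the side given by the sign `ω.2`. -/
def direction (γ : ℝ → X) (x₀ : X) (D : ℝ) (ω : G × ℤˣ) : Set G :=
  {g | ∃ s t, ω.1 • γ s ∈ proj (ω.1 • Set.range γ) x₀ ∧
    ω.1 • γ t ∈ proj (ω.1 • Set.range γ) (g • x₀) ∧ 249 * D ≤ ((ω.2 : ℤ) : ℝ) * (t - s)}

/-- The group element moving the basepoint `γ 0` of the axis of `f` to the point of the translate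
by `ω.1` of the axis which is `n` steps, in the direction of the sign `ω.2`, from the projection
of `x₀`. -/
noncomputable def axisMark (f : G) (γ : ℝ → X) (x₀ : X) (n : ℤ) (ω : G × ℤˣ) : G :=
  ω.1 * f ^ (⌊projParam γ x₀ ω.1⌋ + ω.2 * n)

lemma axisMark_sub_mul (f : G) (γ : ℝ → X) (x₀ : X) (n L : ℤ) (ω : G × ℤˣ) :
    axisMark f γ x₀ (n - L) ω * f ^ ((ω.2 : ℤ) * L) = axisMark f γ x₀ n ω := by
  rw [axisMark, axisMark, mul_assoc, ← zpow_add]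
  congr 2; ring

variable [IsIsometricSMul G X] {δ D : ℝ} {f : G} {γ : ℝ → X}

lemma isometry_smul_line (hγ : Isometry γ) (h : G) (c : ℝ) (σ : ℤˣ) :
    Isometry (fun r : ℝ => h • γ (c + ((σ : ℤ) : ℝ) * r)) := by
  refine Isometry.of_dist_eq fun r r' => ?_
  rw [dist_smul, hγ.dist_eq, Real.dist_eq, Real.dist_eq]
  rcases Int.units_eq_one_or σ with rfl | rfl
  · simp
  · rw [abs_sub_comm r r']; congr 1; push_cast; ring

lemma exists_mem_direction (h4 : FourPoint X δ) (hD0 : 0 < D) (hD : 100 * δ ≤ D)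
    (hγ : Isometry γ) (x₀ : X) {g h : G}
    (hg : 250 * D ≤ projDist (h • Set.range γ) x₀ (g • x₀)) :
    ∃ σ, g ∈ direction γ x₀ D (h, σ) := by
  have hr : Set.range (fun r : ℝ => h • γ r) = h • Set.range γ := by
    simpa using range_smul_line γ h 0 1
  have hi : Isometry (fun r : ℝ => h • γ r) := by simpa using isometry_smul_line hγ h 0 1
  obtain ⟨s, t, hs, ht, hst⟩ := exists_mem_proj_of_le_projDist h4 hi (x := x₀) (y := g • x₀)
    (c := 249 * D) (c' := 250 * D) (by linarith) (by linarith) (by linarith) (by rwa [hr])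
  rw [hr] at hs ht
  rcases le_total s t with hle | hle
  · refine ⟨1, s, t, hs, ht, ?_⟩
    rw [abs_of_nonpos (by linarith)] at hst
    push_cast; linarith
  · refine ⟨-1, s, t, hs, ht, ?_⟩
    rw [abs_of_nonneg (by linarith)] at hst
    push_cast; linarith

lemma dist_axisMark (hγ : IsUnitalAxis f γ) (n : ℤ) (L : ℕ) (ω : G × ℤˣ) :
    dist (axisMark f γ (γ 0) (n - L) ω • γ 0) (axisMark f γ (γ 0) n ω • γ 0) = L := by
  rw [← axisMark_sub_mul f γ (γ 0) n L ω, mul_smul, dist_smul, hγ.zpow_smul, hγ.1.dist_eq,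
    Real.dist_eq]
  rcases Int.units_eq_one_or ω.2 with h | h <;> simp [h]

/-- The mark about `120 * D` steps from the projection of the basepoint in a direction `ω`, and the
mark `L` steps before it, lie on the way to all elements of that direction. The number of steps
leaves room on both sides: the marks are farther than `100 * D` from the basepoint, and well before
the projections of the elements of the direction, which are `249 * D` away. -/
lemma axisMark_of_mem_direction (h4 : FourPoint X δ) (hD1 : 1 ≤ D)
    (hD : 100 * δ ≤ D) (hγ : IsUnitalAxis f γ) {L : ℕ} (hL : (L : ℝ) ≤ D) {ω : G × ℤˣ} {g : G}
    (hg : g ∈ direction γ (γ 0) D ω) :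
    100 * D ≤ dist (γ 0) (axisMark f γ (γ 0) ⌈120 * D⌉ ω • γ 0) ∧
    100 * D ≤ dist (γ 0) (axisMark f γ (γ 0) (⌈120 * D⌉ - L) ω • γ 0) ∧
    dist (γ 0) (axisMark f γ (γ 0) (⌈120 * D⌉ - L) ω • γ 0) + L ≤
      dist (γ 0) (axisMark f γ (γ 0) ⌈120 * D⌉ ω • γ 0) + 4 * δ ∧
    dist (γ 0) (axisMark f γ (γ 0) ⌈120 * D⌉ ω • γ 0) +
      dist (axisMark f γ (γ 0) ⌈120 * D⌉ ω • γ 0) (g • γ 0) ≤ dist (γ 0) (g • γ 0) + 10 * δ := by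
  obtain ⟨h, σ⟩ := ω
  obtain ⟨s, t, hs, ht, hst⟩ := hg
  dsimp only at hs ht hst
  set c := projParam γ (γ 0) h with hc
  have hcm : h • γ c ∈ proj (h • Set.range γ) (γ 0) := smul_projParam_mem hs
  set l : ℝ → X := fun r => h • γ (c + ((σ : ℤ) : ℝ) * r) with hl
  have hlr : Set.range l = h • Set.range γ := range_smul_line γ h c σ
  have hli : Isometry l := isometry_smul_line hγ.1 h c σ
  have hσ : ((σ : ℤ) : ℝ) * ((σ : ℤ) : ℝ) = 1 := by
    rcases Int.units_eq_one_or σ with rfl | rfl <;> simp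
  have hpt : ∀ r, h • γ r = l ((σ : ℤ) * (r - c)) := by
    intro r
    simp only [hl, ← mul_assoc, hσ, one_mul, add_sub_cancel]
  set u : ℝ := ⌈120 * D⌉ + ((σ : ℤ) : ℝ) * (⌊c⌋ - c) with hu
  have hmark : ∀ n : ℤ, axisMark f γ (γ 0) n (h, σ) • γ 0 = l (n + ((σ : ℤ) : ℝ) * (⌊c⌋ - c)) := by
    intro n
    rw [axisMark, mul_smul, hγ.zpow_smul, hpt]
    congr 1
    push_cast
    linear_combination (n : ℝ) * hσ
  have e1 : axisMark f γ (γ 0) ⌈120 * D⌉ (h, σ) • γ 0 = l u := hmark _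
  have e2 : axisMark f γ (γ 0) (⌈120 * D⌉ - L) (h, σ) • γ 0 = l (u - L) := by
    rw [hmark]; congr 1; push_cast; ring
  have hσc : |((σ : ℤ) : ℝ) * (⌊c⌋ - c)| ≤ 1 := by
    have h1 := Int.floor_le c
    have h2 := Int.lt_floor_add_one c
    rw [abs_mul, show |((σ : ℤ) : ℝ)| = 1 by
      rcases Int.units_eq_one_or σ with rfl | rfl <;> simp, one_mul, abs_le]
    constructor <;> linarith
  have hσc' := abs_le.1 hσc
  have hβ1 := Int.le_ceil (120 * D)
  have hβ2 := Int.ceil_lt_add_one (120 * D)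
  rw [e1, e2]
  rw [hpt, ← hlr] at hs ht hcm
  rw [sub_self, mul_zero] at hcm
  have d1 := le_dist_of_mem_proj_zero h4 hli hcm u
  have d2 := le_dist_of_mem_proj_zero h4 hli hcm (u - L)
  refine ⟨by linarith, by linarith, ?_, ?_⟩
  · exact dist_add_le_of_mem_proj_zero h4 hli hcm (Nat.cast_nonneg L) (by linarith)
  · exact dist_add_dist_le_of_far_projection h4 (by linarith) hD hli hcm (by linarith)
      (by linarith) hs ht (by linarith)

end Branching

/-! ### Elements with three heavy directions are few -/

section Heavy

open Finset

variable {G X : Type*} [Group G] [MetricSpace X] [MulAction G X] [IsIsometricSMul G X]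
  {δ D : ℝ} {f : G} {γ : ℝ → X}

/-- Of three directions at `y` that diverge early, at most one points towards the root `o`. -/
lemma exists_pair_of_tripod {α : Type*} (h4 : FourPoint X δ) (hD0 : 0 < D) (hD : 100 * δ ≤ D)
    (o y : X) (q : α → X) (s : Set α) {a b c : α} (ha : a ∈ s) (hb : b ∈ s) (hc : c ∈ s)
    (hab : gromovProduct y (q a) (q b) ≤ 2 * D) (hac : gromovProduct y (q a) (q c) ≤ 2 * D)
    (hbc : gromovProduct y (q b) (q c) ≤ 2 * D) :
    ∃ w : Bool → α, (∀ i, w i ∈ s ∧ gromovProduct y o (q (w i)) ≤ 3 * D) ∧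
      gromovProduct y (q (w true)) (q (w false)) ≤ 2 * D := by
  have key : ∀ a b, gromovProduct y (q a) (q b) ≤ 2 * D → 3 * D < gromovProduct y o (q a) →
      gromovProduct y o (q b) ≤ 3 * D := by
    intro a b hab ha
    by_contra! hb
    have := h4.le_gromovProduct (o := y) (x := q a) (y := o) (z := q b) (c := 3 * D)
      (by rw [gromovProduct_comm]; exact ha.le) hb.le
    linarith
  by_cases h1 : gromovProduct y o (q a) ≤ 3 * D
  · by_cases h2 : gromovProduct y o (q b) ≤ 3 * D
    · exact ⟨fun i => if i then a else b, fun i => by cases i <;> simp [*], by simpa using hab⟩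
    · have h3 := key b c hbc (not_le.1 h2)
      exact ⟨fun i => if i then a else c, fun i => by cases i <;> simp [*], by simpa using hac⟩
  · have h2 := key a b hab (not_le.1 h1)
    have h3 := key a c hac (not_le.1 h1)
    exact ⟨fun i => if i then b else c, fun i => by cases i <;> simp [*], by simpa using hbc⟩

/-- The elements `a` of `A` that see at least `N` points of `A` in each of three diverging
directions number at most a constant times `#A / N`. Two of the three directions point away from
the root `γ 0`. By weak proper discontinuity, a geodesic from the root to the end of a branch carries
boundedly many other branches whose basepoints are at comparable distance from the root, so a
positive proportion of these `a` is separated enough for `card_mul_le_of_branching`. -/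
lemma exists_card_mul_le_of_three_heavy_directions (h4 : FourPoint X δ) (hδ : 0 ≤ δ)
    (hD1 : 1 ≤ D) (hD : 100 * δ ≤ D) (hγ : IsUnitalAxis f γ) {L : ℕ} (hL : (L : ℝ) ≤ D)
    (hW : ∀ σ : ℤˣ, {g : G | dist (γ 0) (g • γ 0) < 50 * δ + 3 ∧
      dist (f ^ ((σ : ℤ) * L) • γ 0) (g • f ^ ((σ : ℤ) * L) • γ 0) < 50 * δ + 3}.Finite)
    (Ω : Finset (G × ℤˣ)) :
    ∃ K : ℕ, ∀ N : ℕ, 1 ≤ N → ∀ A B : Finset G, B ⊆ A →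
      (∀ a ∈ B, ∃ s : Set (G × ℤˣ), (∀ ω ∈ s, ω ∈ Ω ∧
        N ≤ {b ∈ (A : Set G) | a⁻¹ * b ∈ direction γ (γ 0) D ω}.ncard) ∧
        ∃ ω₁ ∈ s, ∃ ω₂ ∈ s, ∃ ω₃ ∈ s,
          gromovProduct (γ 0) (axisMark f γ (γ 0) ⌈120 * D⌉ ω₁ • γ 0)
            (axisMark f γ (γ 0) ⌈120 * D⌉ ω₂ • γ 0) ≤ 2 * D ∧
          gromovProduct (γ 0) (axisMark f γ (γ 0) ⌈120 * D⌉ ω₁ • γ 0)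
            (axisMark f γ (γ 0) ⌈120 * D⌉ ω₃ • γ 0) ≤ 2 * D ∧
          gromovProduct (γ 0) (axisMark f γ (γ 0) ⌈120 * D⌉ ω₂ • γ 0)
            (axisMark f γ (γ 0) ⌈120 * D⌉ ω₃ • γ 0) ≤ 2 * D) →
      #B * N ≤ K * #A := by
  classical
  set o := γ 0 with ho
  set u := axisMark f γ o ⌈120 * D⌉ with hu
  set v := axisMark f γ o (⌈120 * D⌉ - L) with hv
  have hvu : ∀ ω, v ω * f ^ ((ω.2 : ℤ) * L) = u ω := axisMark_sub_mul f γ o _ _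
  set E₁ : ℝ := ∑ ω ∈ Ω, dist o (u ω • o)
  have hE₁' : ∀ ω ∈ Ω, dist o (u ω • o) ≤ E₁ := fun ω hω =>
    Finset.single_le_sum (f := fun ω => dist o (u ω • o)) (fun _ _ => dist_nonneg) hω
  set W : ℕ := ∑ σ : ℤˣ, {g : G | dist o (g • o) < 50 * δ + 3 ∧
      dist (f ^ ((σ : ℤ) * L) • o) (g • f ^ ((σ : ℤ) * L) • o) < 50 * δ + 3}.ncard
  set k₁ : ℕ := ⌊E₁ + (E₁ + 4 * D)⌋₊
  set K₀ : ℕ := W * (2 * (#Ω * (k₁ + 1)))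
  refine ⟨2 * K₀ + 1, fun N hN A B hBA hB => ?_⟩
  have hD0 : 0 < D := by linarith
  have hw : ∀ a ∈ B, ∃ w : Bool → G × ℤˣ, (∀ i, (w i ∈ Ω ∧
      N ≤ {b ∈ (A : Set G) | a⁻¹ * b ∈ direction γ o D (w i)}.ncard) ∧
      gromovProduct (a • o) o ((a * u (w i)) • o) ≤ 3 * D) ∧
      gromovProduct (a • o) ((a * u (w true)) • o) ((a * u (w false)) • o) ≤ 2 * D := by
    intro a ha
    obtain ⟨s, hs, ω₁, h1, ω₂, h2, ω₃, h3, h12, h13, h23⟩ := hB a ha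
    obtain ⟨w, hw1, hw2⟩ := exists_pair_of_tripod h4 hD0 hD o (a • o)
      (fun ω => (a * u ω) • o) s h1 h2 h3
      (by simpa only [mul_smul, gromovProduct_smul] using h12)
      (by simpa only [mul_smul, gromovProduct_smul] using h13)
      (by simpa only [mul_smul, gromovProduct_smul] using h23)
    exact ⟨w, fun i => ⟨hs _ (hw1 i).1, (hw1 i).2⟩, hw2⟩
  choose! w hw hww using hw
  set y : G → X := fun a => a • o
  set q : G → Bool → X := fun a i => (a * u (w a i)) • o with hq
  set P : G → Bool → Finset G := fun a i =>
    A.filter fun b => a⁻¹ * b ∈ direction γ o D (w a i) with hP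
  have hPN : ∀ a ∈ B, ∀ i, N ≤ #(P a i) := by
    intro a ha i
    have := (hw a ha i).1.2
    rwa [show {b ∈ (A : Set G) | a⁻¹ * b ∈ direction γ o D (w a i)} = ↑(P a i) by
      ext; simp [hP], Set.ncard_coe_finset] at this
  have hdist : ∀ a ω, dist (a • o) ((a * u ω) • o) = dist o (u ω • o) := by
    intro a ω; rw [mul_smul, dist_smul]
  -- the geometry of a branch at `y a`, as seen from `y a`
  have hloc : ∀ a ∈ B, ∀ i, ∀ b ∈ P a i, 100 * D ≤ dist (y a) (q a i) ∧
      dist o ((a * v (w a i)) • o) + L ≤ dist o (q a i) + 6 * δ ∧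
      dist (y a) (q a i) + dist (q a i) (b • o) ≤ dist (y a) (b • o) + 10 * δ := by
    intro a ha i b hb
    obtain ⟨g1, g2, g3, g5⟩ := axisMark_of_mem_direction h4 hD1 hD hγ hL (mem_filter.1 hb).2
    have hqa : q a i = a • u (w a i) • o := mul_smul _ _ _
    have hb' : b • o = a • (a⁻¹ * b) • o := by rw [smul_smul, mul_inv_cancel_left]
    refine ⟨(hdist _ _).symm ▸ g1, ?_, ?_⟩
    · refine dist_add_le_of_segment h4 hD0 hD (hw a ha i).2 (p := (a * v (w a i)) • o) ?_ ?_ ?_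
      · rwa [mul_smul, dist_smul]
      · rw [mul_smul, hqa, dist_smul]
        exact dist_axisMark hγ _ _ _
      · rw [mul_smul, hqa, dist_smul, dist_smul]
        exact g3
    · rw [hqa, hb', dist_smul, dist_smul, dist_smul]
      exact g5
  have hne : ∀ a ∈ B, ∀ i, ∃ b, b ∈ P a i := fun a ha i =>
    card_pos.1 (lt_of_lt_of_le hN (hPN a ha i))
  have hyq : ∀ a ∈ B, ∀ i, dist o (y a) + 94 * D ≤ dist o (q a i) := by
    intro a ha i
    obtain ⟨b, hb⟩ := hne a ha i
    exact dist_add_le_of_gromovProduct_le (hw a ha i).2 (hloc a ha i b hb).1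
  have hqy : ∀ a ∈ B, ∀ i, dist o (q a i) ≤ dist o (y a) + E₁ := by
    intro a ha i
    have := dist_triangle o (y a) (q a i)
    have h2 := hE₁' _ (hw a ha i).1.1
    rw [← hdist a] at h2
    linarith
  let r : G → G → Prop := fun a a' => ∃ i i', dist o (q a' i') ≤ dist o (q a i) ∧
    dist o (q a' i') - 8 * δ ≤ gromovProduct o (q a i) (q a' i') ∧
    |dist o (y a) - dist o (y a')| ≤ E₁ + 4 * D
  have hout : ∀ a ∈ B, {a' ∈ (B : Set G) | r a a'}.ncard ≤ K₀ := by
    intro a ha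
    rw [show {a' ∈ (B : Set G) | r a a'} = ↑(B.filter (r a)) by ext; simp, Set.ncard_coe_finset]
    have hr : ∀ a' ∈ B.filter (r a), r a a' := fun a' h => (mem_filter.1 h).2
    choose! i i' h1 h2 h3 using hr
    let lab : G → Bool × (G × ℤˣ) × ℕ := fun a' =>
      (i a', w a' (i' a'), ⌊dist o (q a (i a')) - dist o (q a' (i' a'))⌋₊)
    have himg : (B.filter (r a)).image lab ⊆ univ ×ˢ (Ω ×ˢ range (k₁ + 1)) := by
      intro x hx
      obtain ⟨a', ha', rfl⟩ := mem_image.1 hx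
      have haB' := (mem_filter.1 ha').1
      refine mem_product.2 ⟨mem_univ _, mem_product.2 ⟨(hw a' haB' _).1.1, ?_⟩⟩
      rw [mem_range, Nat.lt_succ_iff]
      refine Nat.floor_le_floor ?_
      have := hqy a ha (i a')
      have := hyq a' haB' (i' a')
      have := (abs_le.1 (h3 a' ha')).2
      linarith
    refine (card_le_mul_card_image (f := lab) _ W ?_).trans ?_
    · rintro ⟨j, ω, k⟩ -
      have hcard := card_le_of_segments h4 hδ (x₀ := o) (f ^ ((ω.2 : ℤ) * L)) (L := L)
        (by rw [ho, hγ.zpow_smul, hγ.1.dist_eq, Real.dist_eq]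
            rcases Int.units_eq_one_or ω.2 with h | h <;> simp [h])
        (hW ω.2) o (q a j) (v ω) (dist o (q a j) - (k + 1))
        ((B.filter (r a)).filter fun a' => lab a' = (j, ω, k)) (by
          intro a' ha'
          obtain ⟨ha1, ha2⟩ := mem_filter.1 ha'
          have haB' := (mem_filter.1 ha1).1
          simp only [lab, Prod.mk.injEq] at ha2
          obtain ⟨rfl, rfl, hk⟩ := ha2
          have hqv : (a' * v (w a' (i' a'))) • f ^ (((w a' (i' a')).2 : ℤ) * L) • o
              = q a' (i' a') := by
            simp only [hq]
            rw [smul_smul, mul_assoc, hvu]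
          rw [hqv]
          obtain ⟨b, hb⟩ := hne a' haB' (i' a')
          have hle := h1 a' ha1
          have hk1 := Nat.floor_le (sub_nonneg.2 hle)
          have hk2 := Nat.lt_floor_add_one (dist o (q a (i a')) - dist o (q a' (i' a')))
          rw [hk] at hk1 hk2
          exact ⟨(hloc a' haB' _ b hb).2.1, h2 a' ha1, by linarith, by linarith⟩)
      refine hcard.trans ?_
      exact Finset.single_le_sum (f := fun σ : ℤˣ => {g : G | dist o (g • o) < 50 * δ + 3 ∧
        dist (f ^ ((σ : ℤ) * L) • o) (g • f ^ ((σ : ℤ) * L) • o) < 50 * δ + 3}.ncard)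
        (fun _ _ => Nat.zero_le _) (mem_univ ω.2)
    · refine Nat.mul_le_mul_left _ ((card_le_card himg).trans ?_)
      simp [card_product]
  obtain ⟨C, hCB, hBC, hC⟩ := exists_independent_subset r K₀ B hout
  have hmain : #C * N ≤ #A := by
    refine card_mul_le_of_branching (E₁ := E₁) h4 hδ hD0 hD o C A y q P (fun b => b • o) N
      (fun a _ i => filter_subset _ _) (fun a ha i => hPN a (hCB ha) i)
      (fun a ha i => hyq a (hCB ha) i) (fun a ha i => hqy a (hCB ha) i)
      (fun a ha => gromovProduct_le_of_tripod (hww a (hCB ha))) ?_ ?_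
      (fun a ha i => le_gromovProduct_of_gromovProduct_le (hw a (hCB ha) i).2) ?_
    · intro a ha i b hb
      have := hloc a (hCB ha) i b hb
      exact (le_gromovProduct_of_behind h4 hD0 hD (hw a (hCB ha) i).2 this.1 this.2.2).1
    · intro a ha i b hb
      have := hloc a (hCB ha) i b hb
      exact (le_gromovProduct_of_behind h4 hD0 hD (hw a (hCB ha) i).2 this.1 this.2.2).2
    · intro a ha a' ha' hne i i' h
      by_contra! hcon
      rcases le_total (dist o (q a' i')) (dist o (q a i)) with hle | hle
      · rw [min_eq_right hle] at h
        exact hC a ha a' ha' hne ⟨i, i', hle, h, hcon⟩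
      · rw [min_eq_left hle, gromovProduct_comm] at h
        rw [abs_sub_comm] at hcon
        exact hC a' ha' a ha hne.symm ⟨i', i, hle, h, hcon⟩
  calc #B * N ≤ (2 * K₀ + 1) * #C * N := Nat.mul_le_mul_right _ hBC
    _ = (2 * K₀ + 1) * (#C * N) := mul_assoc _ _ _
    _ ≤ (2 * K₀ + 1) * #A := Nat.mul_le_mul_left _ hmain

end Heavy

/-! ### Covering by two halfspaces -/

section Halfspaces

open Finset

variable {G X : Type*} [Group G] [MetricSpace X] [MulAction G X] [IsIsometricSMul G X]
  {δ D : ℝ} {f : G} {γ : ℝ → X}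

/-- Every `a` either sees at least `M` points of `A` in each of three diverging directions of `Ω`,
or has two halfspaces containing all points of `A` except those in sparse directions and those
too close to `a`. -/
lemma three_heavy_directions_or_two_halfspaces (h4 : FourPoint X δ) (hD1 : 1 ≤ D)
    (hD : 100 * δ ≤ D) (hγ : IsUnitalAxis f γ) {S : Set G} {E : ℝ} (BE BE' : Finset G)
    (hBE : ∀ h, (wordNorm S h : ℝ) ≤ E → h ∈ BE) {E' : ℝ}
    (hBE' : ∀ h, (wordNorm S h : ℝ) ≤ E' → h ∈ BE') (M : ℕ) (A : Finset G) (a : G) :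
    (∃ s : Set (G × ℤˣ), (∀ ω ∈ s, ω ∈ BE ×ˢ (univ : Finset ℤˣ) ∧
        M ≤ {b ∈ (A : Set G) | a⁻¹ * b ∈ direction γ (γ 0) D ω}.ncard) ∧
        ∃ ω₁ ∈ s, ∃ ω₂ ∈ s, ∃ ω₃ ∈ s,
          gromovProduct (γ 0) (axisMark f γ (γ 0) ⌈120 * D⌉ ω₁ • γ 0)
            (axisMark f γ (γ 0) ⌈120 * D⌉ ω₂ • γ 0) ≤ 2 * D ∧
          gromovProduct (γ 0) (axisMark f γ (γ 0) ⌈120 * D⌉ ω₁ • γ 0)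
            (axisMark f γ (γ 0) ⌈120 * D⌉ ω₃ • γ 0) ≤ 2 * D ∧
          gromovProduct (γ 0) (axisMark f γ (γ 0) ⌈120 * D⌉ ω₂ • γ 0)
            (axisMark f γ (γ 0) ⌈120 * D⌉ ω₃ • γ 0) ≤ 2 * D) ∨
    ∃ u₁ u₂ : G, ((A : Set G) \
      a • ((fHalfspace S γ (γ 0) D E u₁ ∪ fHalfspace S γ (γ 0) D E u₂) \
        {g : G | (wordNorm S g : ℝ) ≤ E'})).ncard ≤ #BE * 2 * M + #BE' := by
  classical
  set o := γ 0 with ho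
  set u := axisMark f γ o ⌈120 * D⌉ with hu
  set Ω : Finset (G × ℤˣ) := BE ×ˢ univ with hΩ
  let s : Set (G × ℤˣ) := {ω | ω ∈ Ω ∧ M ≤ {b ∈ (A : Set G) | a⁻¹ * b ∈ direction γ o D ω}.ncard}
  refine or_iff_not_imp_left.2 fun hcon => ?_
  obtain ⟨ω₁, ω₂, hdom⟩ := exists_two_dominating s
    (fun ω ω' => 2 * D < gromovProduct o (u ω • o) (u ω' • o))
    (fun ω ω' h => by rwa [gromovProduct_comm])
    (fun ω hω ω' hω' ω'' hω'' => by
      by_contra! hno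
      exact hcon ⟨s, fun _ h => h, ω, hω, ω', hω', ω'', hω'', hno.1, hno.2.1, hno.2.2⟩)
  refine ⟨u ω₁, u ω₂, ?_⟩
  -- what is not covered lies in a sparse direction, or in the `E'`-ball around `a`
  let light : Finset G := (Ω.filter fun ω => ω ∉ s).biUnion fun ω =>
    A.filter fun b => a⁻¹ * b ∈ direction γ o D ω
  have hsub : (A : Set G) \ a • ((fHalfspace S γ o D E (u ω₁) ∪ fHalfspace S γ o D E (u ω₂)) \
      {g : G | (wordNorm S g : ℝ) ≤ E'}) ⊆ ↑(light ∪ BE'.image (a * ·)) := by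
    rintro b ⟨hbA, hb⟩
    rw [Set.mem_smul_set_iff_inv_smul_mem, smul_eq_mul, Set.mem_sdiff, not_and_not_right] at hb
    rw [coe_union, Set.mem_union, mem_coe, mem_coe]
    by_contra! hnot
    obtain ⟨hl, hE'⟩ := hnot
    have hns : ¬ (wordNorm S (a⁻¹ * b) : ℝ) ≤ E' := fun h =>
      hE' (mem_image.2 ⟨_, hBE' _ h, mul_inv_cancel_left a b⟩)
    have hnot : ¬ _ := fun h => hns (hb h)
    simp only [Set.mem_union, fHalfspace, Set.mem_ofPred_eq, not_or, not_not] at hnot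
    obtain ⟨⟨hg1, h, hhE, hh⟩, hg2, -⟩ := hnot
    obtain ⟨σ, hσ⟩ := exists_mem_direction h4 (by linarith) hD hγ.1 o hh
    have hω : (h, σ) ∈ Ω := mem_product.2 ⟨hBE h hhE, mem_univ _⟩
    have hs : (h, σ) ∈ s := by
      by_contra hs
      exact hl (mem_biUnion.2 ⟨_, mem_filter.2 ⟨hω, hs⟩, mem_filter.2 ⟨hbA, hσ⟩⟩)
    obtain ⟨k1, -, -, k2⟩ := axisMark_of_mem_direction (L := 0) h4 hD1 hD hγ
      (by push_cast; linarith) hσ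
    have hgp : 2 * D ≤ gromovProduct o ((a⁻¹ * b) • o) (u (h, σ) • o) := by
      rw [gromovProduct_comm]
      unfold gromovProduct
      linarith
    rcases hdom _ hs with hd | hd
    · have := h4.le_gromovProduct hgp hd.le
      exact hg1 (by linarith)
    · have := h4.le_gromovProduct hgp hd.le
      exact hg2 (by linarith)
  refine (Set.ncard_le_ncard hsub (finite_toSet _)).trans ?_
  rw [Set.ncard_coe_finset]
  refine (card_union_le _ _).trans (Nat.add_le_add ?_ card_image_le)
  refine (card_biUnion_le_card_mul _ _ M ?_).trans ?_
  · intro ω hω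
    obtain ⟨hω, hs⟩ := mem_filter.1 hω
    by_contra! hlt
    refine hs ⟨hω, ?_⟩
    rw [show {b ∈ (A : Set G) | a⁻¹ * b ∈ direction γ o D ω} =
      ↑(A.filter fun b => a⁻¹ * b ∈ direction γ o D ω) by ext; simp, Set.ncard_coe_finset]
    exact hlt.le
  · refine Nat.mul_le_mul_right _ ((card_filter_le _ _).trans ?_)
    simp [hΩ, card_product]

end Halfspaces

end MagicWPD

theorem mainTheorem7 {G X : Type*} [Group G] [MetricSpace X] [MulAction G X]
    [IsIsometricSMul G X] (δ : ℝ) (hδ : 0 < δ)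
    (hgeod : MagicWPD.IsGeodesicSpace X) (hhyp : MagicWPD.IsHyperbolic X δ)
    (hG : ¬ MagicWPD.IsVirtuallyCyclic G)
    (S : Set G) (hSfin : S.Finite) (hSgen : Subgroup.closure S = ⊤)
    (f : G) (γ : ℝ → X) (hγ : MagicWPD.IsUnitalAxis f γ)
    (x₀ : X) (hx₀ : x₀ ∈ Set.range γ) (hf : MagicWPD.IsWPD f x₀) :
    ∃ D₀ : ℝ, 0 < D₀ ∧ ∀ ε : ℝ, 0 < ε → ∀ D : ℝ, D₀ < D →
      ∀ E E' : ℝ, 0 ≤ E → 0 ≤ E' → ∃ N : ℕ, ∀ A : Finset G, ∃ A' : Finset G, A' ⊆ A ∧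
        (1 - ε) * (A.card : ℝ) ≤ (A'.card : ℝ) ∧
        ∀ a ∈ A', ∃ u₁ u₂ : G,
          ((A : Set G) \
            a • ((MagicWPD.fHalfspace S γ x₀ D E u₁ ∪ MagicWPD.fHalfspace S γ x₀ D E u₂) \
              {g : G | (MagicWPD.wordNorm S g : ℝ) ≤ E'})).ncard ≤ N := by
  classical
  -- parametrize the axis so that the basepoint is its point with parameter `0`
  obtain ⟨η, hη, rfl, hr⟩ : ∃ η : ℝ → X, MagicWPD.IsUnitalAxis f η ∧ η 0 = x₀ ∧
      Set.range η = Set.range γ := by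
    obtain ⟨t₀, rfl⟩ := hx₀
    refine ⟨fun t => γ (t₀ + t), ⟨hγ.1.comp (isometry_add_left t₀), fun t => ?_⟩, by simp, ?_⟩
    · rw [hγ.2, add_assoc]
    · exact (AddGroup.addLeft_bijective t₀).surjective.range_comp γ
  have hH : ∀ D E u, MagicWPD.fHalfspace S γ (η 0) D E u =
      MagicWPD.fHalfspace S η (η 0) D E u := fun D E u => by
    simp only [MagicWPD.fHalfspace, hr]
  simp only [hH]
  have h4 := hhyp.fourPoint hδ.le hgeod
  obtain ⟨L, hL⟩ := hf.exists_finite (R := 50 * (3 * δ) + 3) (by positivity)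
  refine ⟨L + 100 * (3 * δ) + 1, by positivity, fun ε hε D hD E E' _ _ => ?_⟩
  have hL0 : (0 : ℝ) ≤ L := Nat.cast_nonneg L
  have hBE := MagicWPD.finite_setOf_wordNorm_le hSfin hSgen E
  have hBE' := MagicWPD.finite_setOf_wordNorm_le hSfin hSgen E'
  obtain ⟨K, hK⟩ := MagicWPD.exists_card_mul_le_of_three_heavy_directions h4 (by positivity)
    (D := D) (by linarith) (by linarith) hη (by linarith) hL (hBE.toFinset ×ˢ Finset.univ)
  -- directions are heavy from a size on at which `K * #A / M ≤ ε * #A`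
  set M : ℕ := ⌈K / ε⌉₊ + 1
  refine ⟨hBE.toFinset.card * 2 * M + hBE'.toFinset.card, fun A => ?_⟩
  have hdich := MagicWPD.three_heavy_directions_or_two_halfspaces h4 (D := D) (by linarith)
    (by linarith) hη (S := S) (E := E) (E' := E') hBE.toFinset hBE'.toFinset
    (fun h hh => hBE.mem_toFinset.2 hh) (fun h hh => hBE'.mem_toFinset.2 hh) M A
  set good : G → Prop := fun a => ∃ u₁ u₂ : G, ((A : Set G) \
      a • ((MagicWPD.fHalfspace S η (η 0) D E u₁ ∪ MagicWPD.fHalfspace S η (η 0) D E u₂) \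
        {g : G | (MagicWPD.wordNorm S g : ℝ) ≤ E'})).ncard ≤
      hBE.toFinset.card * 2 * M + hBE'.toFinset.card
  refine ⟨A.filter good, Finset.filter_subset _ _, ?_, fun a ha => (Finset.mem_filter.1 ha).2⟩
  have hB := hK M (by omega) A (A.filter fun a => ¬ good a) (Finset.filter_subset _ _)
    (fun a ha => (hdich a).resolve_right (Finset.mem_filter.1 ha).2)
  have hsum := Finset.card_filter_add_card_filter_not (s := A) good
  have hKM : (K : ℝ) ≤ ε * M := by
    have h1 : (K : ℝ) / ε ≤ M := (Nat.le_ceil _).trans (by exact_mod_cast Nat.le_succ _)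
    rwa [div_le_iff₀' hε] at h1
  have hM0 : (0 : ℝ) < M := by positivity
  have hBε : ((A.filter fun a => ¬ good a).card : ℝ) ≤ ε * A.card := by
    have h1 : ((A.filter fun a => ¬ good a).card : ℝ) * M ≤ K * A.card := by exact_mod_cast hB
    have h2 := mul_le_mul_of_nonneg_right hKM (Nat.cast_nonneg (α := ℝ) A.card)
    refine le_of_mul_le_mul_right ?_ hM0
    linarith
  have hsum' : ((A.filter good).card : ℝ) + (A.filter fun a => ¬ good a).card = A.card := by
    exact_mod_cast hsum
  linarith
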